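/- Let $\mathcal{A}$ be a (not necessarily unital) locally C*-algebra, i.e. a complete Hausdorff complex topological $*$-algebra whose topology is determined by the set $S(\mathcal{A})$ of all its continuous C*-seminorms. Let $E$ and $F$ be (right) Hilbert $\mathcal{A}$-modules, i.e. pre-Hilbert $\mathcal{A}$-modules that are complete for the topology given by the seminorms $\overline{p}_E(x)=\sqrt{p(\langle x,x\rangle)}$, respectively $\overline{p}_F(y)=\sqrt{p(\langle y,y\rangle)}$, $p\in S(\mathcal{A})$. Let $T\in\mathcal{L}_{\mathcal{A}}(E,F)$, i.e. $T:E\to F$ is an $\mathcal{A}$-module map that is bounded (for each $p\in S(\mathcal{A})$ there is $K_p>0$ with $\overline{p}_F(Tx)\le K_p\,\overline{p}_E(x)$ for all $x\in E$) and has an adjoint $\mathcal{A}$-module map $T^*:F\to E$, $\langle Tx,y\rangle=\langle x,T^*y\rangle$ for all $x\in E$, $y\in F$. Then $Ran(T)$ is closed in $F$ if and only if both of the following hold: (a) $Ker(T)$ is orthogonally complemented in $E$, i.e. $E=Ker(T)\oplus Ker(T)^{\perp}$; (b) $T$ is bounded below on $Ker(T)^{\perp}$, i.e. for each $p\in S(\mathcal{A})$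 there exists $c_p>0$ such that $\overline{p}_F(Tx)\ge c_p\,\overline{p}_E(x)$ for all $x\in Ker(T)^{\perp}$. In this case, the restriction $T|_{Ker(T)^{\perp}}:Ker(T)^{\perp}\to Ran(T)$ is bijective, and its inverse $(T|_{Ker(T)^{\perp}})^{-1}:Ran(T)\to Ker(T)^{\perp}$ is a bounded $\mathcal{A}$-module map: it is $\mathcal{A}$-linear, and for each $p\in S(\mathcal{A})$ there is $K_p>0$ with $\overline{p}_E\big((T|_{Ker(T)^{\perp}})^{-1}y\big)\le K_p\,\overline{p}_F(y)$ for all $y\in Ran(T)$. -/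

import Mathlib

open Filter Topology
open scoped RightActions

/-- The set `S(A)` of all continuous C⋆-seminorms on a topological `*`-algebra `A`. -/
def contCStarSeminorms (A : Type*) [NonUnitalRing A] [StarRing A] [Module ℂ A]
    [TopologicalSpace A] : Set (Seminorm ℂ A) :=
  {p | Continuous p ∧ (∀ a b : A, p (a * b) ≤ p a * p b) ∧
    ∀ a : A, p (star a * a) = p a ^ 2}

/-- A (not necessarily unital) locally C⋆-algebra: a complete Hausdorff complex topological
`*`-algebra in which a filter (equivalently, a net) converges to `0` if and only if its image
under every continuous C⋆-seminorm converges to `0`. -/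
class LocallyCStarAlgebra (A : Type*) [NonUnitalRing A] [StarRing A] [Module ℂ A]
    [IsScalarTower ℂ A A] [SMulCommClass ℂ A A] [StarModule ℂ A] [UniformSpace A] : Prop
    extends IsUniformAddGroup A, CompleteSpace A, T2Space A, IsTopologicalRing A,
      ContinuousSMul ℂ A, ContinuousStar A where
  tendsto_zero_iff : ∀ l : Filter A,
    l ≤ 𝓝 0 ↔ ∀ p ∈ contCStarSeminorms A, Tendsto (fun a => p a) l (𝓝 0)

/-- Positivity in a locally C⋆-algebra. -/
def IsPositiveElem {A : Type*} [NonUnitalRing A] [StarRing A] (a : A) : Prop :=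
  ∃ b : A, a = star b * b

/-- A right pre-Hilbert module over a `*`-algebra `A`. The right action of `a : A` on `x : E` is
written `x <• a`, and `inner A x y` is linear in `y`. -/
class PreHilbertModule (A E : Type*) [NonUnitalRing A] [StarRing A] [Module ℂ A]
    [AddCommGroup E] [Module ℂ E] [SMul Aᵐᵒᵖ E] extends Inner A E where
  add_op_smul : ∀ (x y : E) (a : A), (x + y) <• a = x <• a + y <• a
  op_smul_add : ∀ (x : E) (a b : A), x <• (a + b) = x <• a + x <• b
  op_smul_mul : ∀ (x : E) (a b : A), x <• (a * b) = (x <• a) <• b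
  smul_op_smul : ∀ (z : ℂ) (x : E) (a : A), (z • x) <• a = z • (x <• a)
  op_smul_smul : ∀ (z : ℂ) (x : E) (a : A), x <• (z • a) = z • (x <• a)
  inner_add_right : ∀ x y z : E, inner x (y + z) = inner x y + inner x z
  inner_smul_right : ∀ (z : ℂ) (x y : E), inner x (z • y) = z • inner x y
  inner_op_smul_right : ∀ (x y : E) (a : A), inner x (y <• a) = inner x y * a
  star_inner : ∀ x y : E, star (inner y x) = inner x y
  inner_self_pos : ∀ x : E, IsPositiveElem (inner x x)
  inner_self_eq_zero : ∀ x : E, inner x x = 0 ↔ x = 0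

section

variable (A : Type*) {E F : Type*} [NonUnitalRing A] [StarRing A] [Module ℂ A]
  [AddCommGroup E] [Module ℂ E] [SMul Aᵐᵒᵖ E] [PreHilbertModule A E]
  [AddCommGroup F] [Module ℂ F] [SMul Aᵐᵒᵖ F] [PreHilbertModule A F]

/-- The seminorm `x ↦ √(p ⟨x, x⟩)` on a pre-Hilbert `A`-module. -/
noncomputable def moduleSeminorm {A : Type*} {E : Type*} [NonUnitalRing A] [StarRing A]
    [Module ℂ A] [AddCommGroup E] [Module ℂ E] [SMul Aᵐᵒᵖ E] [PreHilbertModule A E]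
    (p : Seminorm ℂ A) (x : E) : ℝ :=
  √(p (inner A x x))

/-- A Hilbert module over `A`: a pre-Hilbert module that carries the topology (and the uniformity
of the additive group) given by the seminorms `moduleSeminorm p`, `p ∈ S(A)`, and is complete. -/
class HilbertModule (A E : Type*) [NonUnitalRing A] [StarRing A] [Module ℂ A]
    [TopologicalSpace A] [AddCommGroup E] [Module ℂ E] [SMul Aᵐᵒᵖ E] [PreHilbertModule A E]
    [UniformSpace E] : Prop where
  isUniformAddGroup : IsUniformAddGroup E
  tendsto_zero_iff : ∀ l : Filter E, l ≤ 𝓝 0 ↔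
    ∀ p ∈ contCStarSeminorms A, Tendsto (fun x => moduleSeminorm p x) l (𝓝 0)
  completeSpace : CompleteSpace E

/-- `A`-linearity of a complex linear map. -/
def IsModuleMap (T : E →ₗ[ℂ] F) : Prop :=
  ∀ (x : E) (a : A), T (x <• a) = T x <• a

/-- Boundedness of a map, seminorm by seminorm. -/
def IsBoundedMap [TopologicalSpace A] (T : E →ₗ[ℂ] F) : Prop :=
  ∀ p ∈ contCStarSeminorms A, ∃ K : ℝ, 0 < K ∧
    ∀ x : E, moduleSeminorm p (T x) ≤ K * moduleSeminorm p x

/-- Existence of an adjoint module map. -/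
def IsAdjointableMap (T : E →ₗ[ℂ] F) : Prop :=
  ∃ S : F →ₗ[ℂ] E, IsModuleMap A S ∧
    ∀ (x : E) (y : F), inner A (T x) y = inner A x (S y)

variable (E F) in
/-- The set `L_A(E, F)` of all bounded adjointable `A`-module maps from `E` to `F`. -/
def adjointableMaps [TopologicalSpace A] : Set (E →ₗ[ℂ] F) :=
  {T | IsModuleMap A T ∧ IsBoundedMap A T ∧ IsAdjointableMap A T}

/-- The orthogonal complement of `X` with respect to the `A`-valued inner product. -/
def orthCompl (X : Submodule ℂ E) : Submodule ℂ E where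
  carrier := {y | ∀ x ∈ X, inner A x y = 0}
  add_mem' := by
    intro y z hy hz x hx
    rw [PreHilbertModule.inner_add_right, hy x hx, hz x hx, add_zero]
  zero_mem' := by
    intro x _
    have h := PreHilbertModule.inner_smul_right (A := A) (0 : ℂ) x 0
    rwa [zero_smul, zero_smul] at h
  smul_mem' := by
    intro z y hy x hx
    rw [PreHilbertModule.inner_smul_right, hy x hx, smul_zero]

/-- `X` is orthogonally complemented: `E` is the direct sum of `X` and `X^⊥`. -/
def IsOrthogonallyComplemented (X : Submodule ℂ E) : Prop :=
  IsCompl X (orthCompl A X)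

/-- The restriction `T| : Ker(T)^⊥ → Ran(T)`. -/
def restrictKerCompl (T : E →ₗ[ℂ] F) : orthCompl A (LinearMap.ker T) →ₗ[ℂ] LinearMap.range T :=
  T.rangeRestrict ∘ₗ (orthCompl A (LinearMap.ker T)).subtype

end

theorem op_smul_mem_range {A E F : Type*} [AddCommGroup E] [Module ℂ E] [SMul Aᵐᵒᵖ E]
    [AddCommGroup F] [Module ℂ F] [SMul Aᵐᵒᵖ F] {T : E →ₗ[ℂ] F} (hT : IsModuleMap A T) {y : F}
    (hy : y ∈ LinearMap.range T) (a : A) : y <• a ∈ LinearMap.range T := by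
  obtain ⟨x, rfl⟩ := hy
  exact ⟨x <• a, hT x a⟩

/-! The hard direction starts from a closed range `G = Ran T`. Write `S` for the adjoint and ‖·‖_p
for the module seminorms. Since `S(A)` may be uncountable, Baire arguments are not available; each
step must serve all seminorms at once while using completeness only through explicit limits.

The crux is ‖y‖_p ≤ C‖S y‖_p on `G` (`exists_moduleSeminorm_le_adjoint`). If it fails, there are `y
n` in `G` with ‖y n‖_p = 100^n and ‖S (y n)‖_p ≤ 1. A gliding hump (`exists_seminorm_inner_ge`)
yields `T e` in `G` with p⟨y n, T e⟩ at least of order 10^n, whereas ⟨y n, T e⟩ = ⟨S (y n), e⟩ is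
bounded in `p`. The humps must be bounded in every seminorm, yet almost norm `y n` in `p`. They come
from resolvents of w ↦ y⟨y, w⟩ (`exists_bounded_almost_norming`). Resolvents of positive operators
come from an iteration (`exists_smul_add_eq`) whose step sizes do not depend on the seminorm.

The crux makes `T S` bounded below on `G`, and letting ε → 0 in `ε + T S` shows that `T S` maps `G`
onto `G`. Solving `T S z = T x` splits `x` as `(x - S z) + S z`, which gives (a), and a
Cauchy–Schwarz estimate gives (b). The converse lifts points of the range to Ker(T)^⊥, where the
lower bounds turn convergence into the Cauchy property. -/

/-! ### Hausdorff completion of a seminormed `*`-algebra. -/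

section CStarCompletion

open UniformSpace

variable {A : Type*} [NonUnitalSeminormedRing A]

noncomputable instance completionNonUnitalMul : Mul (Completion A) :=
  ⟨Function.curry <| ((Completion.isDenseInducing_coe (α := A)).prodMap
    Completion.isDenseInducing_coe).extend ((↑) ∘ Function.uncurry (· * ·))⟩

theorem completion_coe_mul (a b : A) : ((a * b : A) : Completion A) = a * b :=
  ((Completion.isDenseInducing_coe.prodMap Completion.isDenseInducing_coe).extend_eq
      ((Completion.continuous_coe A).comp (@continuous_mul A _ _ _)) (a, b)).symm

instance completionNonUnitalContinuousMul : ContinuousMul (Completion A) where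
  continuous_mul := by
    let m := (AddMonoidHom.mul : A →+ A →+ A).compr₂ Completion.toCompl
    have : Continuous fun p : A × A => m p.1 p.2 :=
      (Completion.continuous_coe A).comp continuous_mul
    have di : IsDenseInducing (Completion.toCompl : A → Completion A) :=
      Completion.isDenseInducing_coe
    exact (di.extend_Z_bilin di this :)

noncomputable instance completionNonUnitalNormedRing : NonUnitalNormedRing (Completion A) where
  __ : NormedAddCommGroup (Completion A) := inferInstance
  zero_mul a :=
    Completion.induction_on a (isClosed_eq (by fun_prop) continuous_const)
      fun a => by rw [← Completion.coe_zero, ← completion_coe_mul, zero_mul]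
  mul_zero a :=
    Completion.induction_on a (isClosed_eq (by fun_prop) continuous_const)
      fun a => by rw [← Completion.coe_zero, ← completion_coe_mul, mul_zero]
  mul_assoc a b c :=
    Completion.induction_on₃ a b c (isClosed_eq (by fun_prop) (by fun_prop))
      fun a b c => by simp only [← completion_coe_mul, mul_assoc]
  left_distrib a b c :=
    Completion.induction_on₃ a b c (isClosed_eq (by fun_prop) (by fun_prop))
      fun a b c => by simp only [← completion_coe_mul, ← Completion.coe_add, mul_add]
  right_distrib a b c :=
    Completion.induction_on₃ a b c (isClosed_eq (by fun_prop) (by fun_prop))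
      fun a b c => by simp only [← completion_coe_mul, ← Completion.coe_add, add_mul]
  norm_mul_le x y := by
    induction x, y using Completion.induction_on₂ with
    | hp => apply isClosed_le <;> fun_prop
    | ih x y => simpa only [← completion_coe_mul, Completion.norm_coe] using norm_mul_le x y

theorem completion_smul_mul [NormedSpace ℂ A] [IsScalarTower ℂ A A] (z : ℂ) (a b : Completion A) : (z • a) * b = z • (a * b) :=
  Completion.induction_on₂ a b
    (isClosed_eq ((continuous_fst.const_smul z).mul continuous_snd)
      ((continuous_fst.mul continuous_snd).const_smul z))
    fun a b => by
      rw [← Completion.coe_smul, ← completion_coe_mul, ← completion_coe_mul,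
        ← Completion.coe_smul, smul_mul_assoc]

theorem completion_mul_smul [NormedSpace ℂ A] [SMulCommClass ℂ A A] (z : ℂ) (a b : Completion A) : a * (z • b) = z • (a * b) :=
  Completion.induction_on₂ a b
    (isClosed_eq (continuous_fst.mul (continuous_snd.const_smul z))
      ((continuous_fst.mul continuous_snd).const_smul z))
    fun a b => by
      rw [← Completion.coe_smul, ← completion_coe_mul, ← completion_coe_mul,
        ← Completion.coe_smul, mul_smul_comm]

variable [StarRing A] [NormedStarGroup A]

noncomputable instance completionStar : Star (Completion A) := ⟨Completion.map star⟩

theorem completion_coe_star (a : A) : ((star a : A) : Completion A) = star (a : Completion A) :=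
  (Completion.map_coe (starNormedAddGroupHom (E := A)).uniformContinuous a).symm

instance completionContinuousStar : ContinuousStar (Completion A) :=
  ⟨Completion.continuous_map⟩

noncomputable instance completionStarRing : StarRing (Completion A) where
  star_involutive a :=
    Completion.induction_on a (isClosed_eq (by fun_prop) (by fun_prop))
      fun a => by simp only [← completion_coe_star, star_star]
  star_mul a b :=
    Completion.induction_on₂ a b (isClosed_eq (by fun_prop) (by fun_prop))
      fun a b => by simp only [← completion_coe_star, ← completion_coe_mul, star_mul]
  star_add a b :=
    Completion.induction_on₂ a b (isClosed_eq (by fun_prop) (by fun_prop))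
      fun a b => by simp only [← completion_coe_star, ← Completion.coe_add, star_add]

theorem completion_star_smul [NormedSpace ℂ A] [StarModule ℂ A] (z : ℂ) (a : Completion A) : star (z • a) = star z • star a :=
  Completion.induction_on a
    (isClosed_eq (continuous_star.comp (continuous_const_smul z))
      ((continuous_const_smul (star z)).comp continuous_star))
    fun a => by
      rw [← Completion.coe_smul, ← completion_coe_star, ← completion_coe_star,
        ← Completion.coe_smul, star_smul]

theorem completion_norm_mul_self_le (h : ∀ a : A, ‖a‖ * ‖a‖ ≤ ‖star a * a‖)
    (a : Completion A) : ‖a‖ * ‖a‖ ≤ ‖star a * a‖ := by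
  induction a using Completion.induction_on with
  | hp => exact isClosed_le (by fun_prop) (by fun_prop)
  | ih a =>
    rw [← completion_coe_star, ← completion_coe_mul, Completion.norm_coe, Completion.norm_coe]
    exact h a

/-- The completion of a `*`-algebra for a C⋆-seminorm is a C⋆-algebra. -/
noncomputable abbrev completionCStarAlgebra [NormedSpace ℂ A] [IsScalarTower ℂ A A]
    [SMulCommClass ℂ A A] [StarModule ℂ A] (h : ∀ a : A, ‖a‖ * ‖a‖ ≤ ‖star a * a‖) :
    NonUnitalCStarAlgebra (Completion A) where
  norm_mul_self_le := completion_norm_mul_self_le h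
  toModule := inferInstance
  norm_smul_le z a := norm_smul_le z a
  smul_assoc := completion_smul_mul
  smul_comm z a b := (completion_mul_smul z a b).symm
  star_smul := completion_star_smul

end CStarCompletion

/-! ### Monotonicity of C⋆-seminorms. -/

section CStarSeminorm

variable {A : Type*} [NonUnitalRing A] [StarRing A] [Module ℂ A]

theorem cstarSeminorm_star {p : Seminorm ℂ A} (hmul : ∀ a b : A, p (a * b) ≤ p a * p b)
    (hstar : ∀ a : A, p (star a * a) = p a ^ 2) (a : A) : p (star a) = p a := by
  have key : ∀ a : A, p a ≤ p (star a) := by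
    intro a
    have h := hmul (star a) a
    rw [hstar] at h
    rcases (apply_nonneg p a).eq_or_lt with h0 | h0
    · rw [← h0]; exact apply_nonneg p _
    · nlinarith
  exact le_antisymm (by simpa using key (star a)) (key a)

/-- C⋆-seminorms are monotone on positive elements. -/
theorem cstarSeminorm_le_of_positive [IsScalarTower ℂ A A] [SMulCommClass ℂ A A] [StarModule ℂ A]
    {p : Seminorm ℂ A} (hmul : ∀ a b : A, p (a * b) ≤ p a * p b)
    (hstar : ∀ a : A, p (star a * a) = p a ^ 2) {a b c : A} (ha : IsPositiveElem a)
    (hb : IsPositiveElem b) (hc : IsPositiveElem c) : p a ≤ p (a + b + c) := by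
  -- With `p` as the norm, the completion is a C⋆-algebra: being Hausdorff, it kills the kernel of
  -- `p`. Its norm is monotone on positive elements, and elements `star d * d` stay positive there.
  let : NonUnitalSeminormedRing A :=
    { (inferInstance : NonUnitalRing A), p.toAddGroupSeminorm.toSeminormedAddCommGroup with
      norm_mul_le := hmul }
  let : NormedSpace ℂ A := { norm_smul_le := fun z a => (map_smul_eq_mul p z a).le }
  have : NormedStarGroup A := ⟨fun a => (cstarSeminorm_star hmul hstar a).le⟩
  let : NonUnitalCStarAlgebra (UniformSpace.Completion A) :=
    completionCStarAlgebra fun a => by rw [← pow_two]; exact (hstar a).ge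
  let := CStarAlgebra.spectralOrder (UniformSpace.Completion A)
  have := CStarAlgebra.spectralOrderedRing (UniformSpace.Completion A)
  have hpos : ∀ a : A, IsPositiveElem a → 0 ≤ (a : UniformSpace.Completion A) := by
    rintro _ ⟨d, rfl⟩
    rw [completion_coe_mul, completion_coe_star]
    exact star_mul_self_nonneg _
  have h := CStarAlgebra.norm_le_norm_of_nonneg_of_le (hpos a ha)
    (le_add_of_le_of_nonneg (le_add_of_nonneg_right (hpos b hb)) (hpos c hc))
  rw [← UniformSpace.Completion.coe_add, ← UniformSpace.Completion.coe_add,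
    UniformSpace.Completion.norm_coe, UniformSpace.Completion.norm_coe] at h
  exact h

end CStarSeminorm

/-! ### Seminorm inequalities in pre-Hilbert modules. -/

section PreHilbert

variable {A E F : Type*} [NonUnitalRing A] [StarRing A] [Module ℂ A]
  [AddCommGroup E] [Module ℂ E] [SMul Aᵐᵒᵖ E] [PreHilbertModule A E]
  [AddCommGroup F] [Module ℂ F] [SMul Aᵐᵒᵖ F] [PreHilbertModule A F]

theorem IsPositiveElem.ofReal_smul [IsScalarTower ℂ A A] [SMulCommClass ℂ A A] [StarModule ℂ A]
    {a : A} (ha : IsPositiveElem a) {r : ℝ} (hr : 0 ≤ r) : IsPositiveElem ((r : ℂ) • a) := by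
  obtain ⟨b, rfl⟩ := ha
  refine ⟨((√r : ℝ) : ℂ) • b, ?_⟩
  rw [star_smul, smul_mul_smul_comm, Complex.star_def, Complex.conj_ofReal, ← Complex.ofReal_mul,
    Real.mul_self_sqrt hr]

theorem inner_add_left_right (x y z : E) : inner A (x + y) z = inner A x z + inner A y z := by
  rw [← PreHilbertModule.star_inner, PreHilbertModule.inner_add_right, star_add,
    PreHilbertModule.star_inner, PreHilbertModule.star_inner]

theorem inner_smul_left_star [StarModule ℂ A] (z : ℂ) (x y : E) :
    inner A (z • x) y = star z • inner A x y := by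
  rw [← PreHilbertModule.star_inner, PreHilbertModule.inner_smul_right, star_smul,
    PreHilbertModule.star_inner]

theorem inner_ofReal_smul_left [StarModule ℂ A] (r : ℝ) (x y : E) :
    inner A ((r : ℂ) • x) y = (r : ℂ) • inner A x y := by
  rw [inner_smul_left_star, Complex.star_def, Complex.conj_ofReal]

theorem inner_op_smul_left (x y : E) (a : A) : inner A (x <• a) y = star a * inner A x y := by
  rw [← PreHilbertModule.star_inner, PreHilbertModule.inner_op_smul_right, star_mul,
    PreHilbertModule.star_inner]

theorem inner_zero_right_eq (x : E) : inner A x (0 : E) = 0 := by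
  have h := PreHilbertModule.inner_smul_right (A := A) (0 : ℂ) x 0
  rwa [zero_smul, zero_smul] at h

theorem inner_neg_right_eq (x y : E) : inner A x (-y) = -inner A x y := by
  have h := PreHilbertModule.inner_smul_right (A := A) (-1 : ℂ) x y
  simpa using h

theorem inner_sub_right_eq (x y z : E) : inner A x (y - z) = inner A x y - inner A x z := by
  rw [sub_eq_add_neg, PreHilbertModule.inner_add_right, inner_neg_right_eq, sub_eq_add_neg]

theorem moduleSeminorm_nonneg (p : Seminorm ℂ A) (x : E) : 0 ≤ moduleSeminorm p x :=
  Real.sqrt_nonneg _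

theorem moduleSeminorm_sq (p : Seminorm ℂ A) (x : E) :
    moduleSeminorm p x ^ 2 = p (inner A x x) :=
  Real.sq_sqrt (apply_nonneg p _)

theorem moduleSeminorm_smul [StarModule ℂ A] (p : Seminorm ℂ A) (z : ℂ) (x : E) :
    moduleSeminorm p (z • x) = ‖z‖ * moduleSeminorm p x := by
  rw [moduleSeminorm, PreHilbertModule.inner_smul_right, inner_smul_left_star, map_smul_eq_mul,
    map_smul_eq_mul, norm_star, ← mul_assoc, Real.sqrt_mul (by positivity),
    Real.sqrt_mul_self (norm_nonneg z), moduleSeminorm]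

theorem moduleSeminorm_ofReal_smul [StarModule ℂ A] {r : ℝ} (hr : 0 ≤ r) (p : Seminorm ℂ A) (x : E) :
    moduleSeminorm p ((r : ℂ) • x) = r * moduleSeminorm p x := by
  rw [moduleSeminorm_smul, Complex.norm_real, Real.norm_of_nonneg hr]

section CStar

variable [TopologicalSpace A] {p : Seminorm ℂ A}

theorem seminorm_star (hp : p ∈ contCStarSeminorms A) (a : A) : p (star a) = p a :=
  cstarSeminorm_star hp.2.1 hp.2.2 a

theorem moduleSeminorm_op_smul_le (hp : p ∈ contCStarSeminorms A) (x : E) (a : A) :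
    moduleSeminorm p (x <• a) ≤ moduleSeminorm p x * p a := by
  refine le_of_sq_le_sq ?_ (mul_nonneg (moduleSeminorm_nonneg p x) (apply_nonneg p a))
  rw [moduleSeminorm_sq, mul_pow, moduleSeminorm_sq, PreHilbertModule.inner_op_smul_right,
    inner_op_smul_left]
  have h1 := hp.2.1 (star a * inner A x x) a
  have h2 := mul_le_mul_of_nonneg_right (hp.2.1 (star a) (inner A x x)) (apply_nonneg p a)
  rw [seminorm_star hp] at h2
  linarith

variable [IsScalarTower ℂ A A] [SMulCommClass ℂ A A] [StarModule ℂ A]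

theorem seminorm_le_add_add (hp : p ∈ contCStarSeminorms A) {a b c : A} (ha : IsPositiveElem a)
    (hb : IsPositiveElem b) (hc : IsPositiveElem c) : p a ≤ p (a + b + c) :=
  cstarSeminorm_le_of_positive hp.2.1 hp.2.2 ha hb hc

theorem seminorm_le_add (hp : p ∈ contCStarSeminorms A) {a b : A} (ha : IsPositiveElem a)
    (hb : IsPositiveElem b) : p a ≤ p (a + b) := by
  have h := seminorm_le_add_add (c := 0) hp ha hb ⟨0, by simp⟩
  rwa [add_zero] at h

/-- Cauchy–Schwarz inequality for the seminorms of a pre-Hilbert module. -/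
theorem seminorm_inner_le (hp : p ∈ contCStarSeminorms A) (x y : E) :
    p (inner A x y) ≤ moduleSeminorm p x * moduleSeminorm p y := by
  set h := inner A x y with hh
  -- Expand ⟨y - s·xh, y - s·xh⟩ with h = ⟨x, y⟩, move the cross terms 2s·h*h to the other side, and
  -- use monotonicity of `p`.
  have key : ∀ s : ℝ, 0 ≤ s → 2 * s * p h ^ 2 ≤
      moduleSeminorm p y ^ 2 + s ^ 2 * (moduleSeminorm p x ^ 2 * p h ^ 2) := by
    intro s hs
    have e : ((2 * s : ℝ) : ℂ) • (star h * h) +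
        inner A (y + ((-s : ℝ) : ℂ) • (x <• h)) (y + ((-s : ℝ) : ℂ) • (x <• h)) =
        inner A y y + ((s ^ 2 : ℝ) : ℂ) • (star h * inner A x x * h) := by
      have hyx : inner A y x = star h := by rw [hh, PreHilbertModule.star_inner]
      simp only [PreHilbertModule.inner_add_right, inner_add_left_right, inner_ofReal_smul_left,
        PreHilbertModule.inner_smul_right, inner_op_smul_left,
        PreHilbertModule.inner_op_smul_right, hyx, ← hh, mul_assoc, add_mul,
        smul_mul_assoc]
      push_cast
      module
    have h1 := seminorm_le_add hp (IsPositiveElem.ofReal_smul ⟨h, rfl⟩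
      (by positivity : (0 : ℝ) ≤ 2 * s)) (PreHilbertModule.inner_self_pos (A := A)
        (y + ((-s : ℝ) : ℂ) • (x <• h)))
    rw [e, map_smul_eq_mul, hp.2.2, Complex.norm_real, Real.norm_of_nonneg (by positivity)] at h1
    refine h1.trans ((map_add_le_add p _ _).trans ?_)
    rw [map_smul_eq_mul, Complex.norm_real, Real.norm_of_nonneg (by positivity),
      moduleSeminorm_sq, moduleSeminorm_sq]
    gcongr
    have h1 := hp.2.1 (star h * inner A x x) h
    have h2 := mul_le_mul_of_nonneg_right (hp.2.1 (star h) (inner A x x)) (apply_nonneg p h)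
    rw [seminorm_star hp] at h2
    linarith
  have hX := moduleSeminorm_nonneg p x
  have hY := moduleSeminorm_nonneg p y
  have hH := apply_nonneg p h
  generalize moduleSeminorm p x = X at *
  generalize moduleSeminorm p y = Y at *
  generalize p h = H at *
  rcases hX.eq_or_lt with h0 | h0
  -- For X = 0 the bound 2sH² ≤ Y² holds for all s, so a large s forces H = 0; for X > 0 the optimal
  -- value is s = 1/X².
  · subst h0
    by_contra hc
    have hc : 0 < H := by linarith
    have := key ((Y ^ 2 + 1) / (2 * H ^ 2)) (by positivity)
    have e : 2 * ((Y ^ 2 + 1) / (2 * H ^ 2)) * H ^ 2 = Y ^ 2 + 1 := by field_simp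
    rw [e] at this
    norm_num at this
  · have := key (1 / X ^ 2) (by positivity)
    have e1 : 2 * (1 / X ^ 2) * H ^ 2 = 2 * (H / X) ^ 2 := by field_simp
    have e2 : (1 / X ^ 2) ^ 2 * (X ^ 2 * H ^ 2) = (H / X) ^ 2 := by field_simp
    rw [e1, e2] at this
    have h3 : H / X ≤ Y := le_of_sq_le_sq (by linarith) hY
    rw [div_le_iff₀ h0] at h3
    linarith

theorem moduleSeminorm_add_le (hp : p ∈ contCStarSeminorms A) (x y : E) :
    moduleSeminorm p (x + y) ≤ moduleSeminorm p x + moduleSeminorm p y := by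
  refine le_of_sq_le_sq ?_ (add_nonneg (moduleSeminorm_nonneg p x) (moduleSeminorm_nonneg p y))
  rw [moduleSeminorm_sq, PreHilbertModule.inner_add_right, inner_add_left_right,
    inner_add_left_right]
  have h1 := map_add_le_add p (inner A x x + inner A y x) (inner A x y + inner A y y)
  have h2 := map_add_le_add p (inner A x x) (inner A y x)
  have h3 := map_add_le_add p (inner A x y) (inner A y y)
  have h4 := seminorm_inner_le hp x y
  have h5 := seminorm_inner_le hp y x
  rw [← moduleSeminorm_sq] at h2 h3
  nlinarith

variable (E) in
/-- The map `moduleSeminorm p` bundled as a seminorm. -/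
noncomputable def hilbertSeminorm (hp : p ∈ contCStarSeminorms A) : Seminorm ℂ E :=
  Seminorm.of (moduleSeminorm p) (moduleSeminorm_add_le hp) (moduleSeminorm_smul p)

theorem moduleSeminorm_sub_le (hp : p ∈ contCStarSeminorms A) (x y : E) :
    moduleSeminorm p (x - y) ≤ moduleSeminorm p x + moduleSeminorm p y :=
  map_sub_le_add (hilbertSeminorm E hp) x y

theorem moduleSeminorm_sub_rev (hp : p ∈ contCStarSeminorms A) (x y : E) :
    moduleSeminorm p (x - y) = moduleSeminorm p (y - x) :=
  map_sub_rev (hilbertSeminorm E hp) x y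

theorem moduleSeminorm_zero (hp : p ∈ contCStarSeminorms A) :
    moduleSeminorm p (0 : E) = 0 :=
  map_zero (hilbertSeminorm E hp)

theorem moduleSeminorm_sub_le_add_sub (hp : p ∈ contCStarSeminorms A) (x y z : E) :
    moduleSeminorm p (x - z) ≤ moduleSeminorm p (x - y) + moduleSeminorm p (y - z) := by
  simpa using moduleSeminorm_add_le hp (x - y) (y - z)

/-- An adjoint of a bounded map is bounded, with the same constants. -/
theorem moduleSeminorm_adjoint_le (hp : p ∈ contCStarSeminorms A) {T : E →ₗ[ℂ] F}
    {S : F →ₗ[ℂ] E} (hS : ∀ x y, inner A (T x) y = inner A x (S y)) {K : ℝ} (hK : 0 ≤ K)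
    (hT : ∀ x, moduleSeminorm p (T x) ≤ K * moduleSeminorm p x) (y : F) :
    moduleSeminorm p (S y) ≤ K * moduleSeminorm p y := by
  have h1 := seminorm_inner_le hp (T (S y)) y
  rw [hS, ← moduleSeminorm_sq] at h1
  have h2 := mul_le_mul_of_nonneg_right (hT (S y)) (moduleSeminorm_nonneg p y)
  have h3 := moduleSeminorm_nonneg p (S y)
  have h4 := mul_nonneg hK (moduleSeminorm_nonneg p y)
  rcases h3.eq_or_lt with h0 | h0
  · rw [← h0]; exact h4
  · nlinarith

/-- The square of the right side is `p` of ⟨r, r⟩ + 2l⟨r, Pr⟩ + l²⟨Pr, Pr⟩, a sum of positive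
elements, and `p` is monotone. -/
theorem moduleSeminorm_le_add_smul (hp : p ∈ contCStarSeminorms A) {P : E →ₗ[ℂ] E}
    (hsym : ∀ x y, inner A (P x) y = inner A x (P y))
    (hpos : ∀ x, IsPositiveElem (inner A x (P x))) {l : ℝ} (hl : 0 ≤ l) (r : E) :
    moduleSeminorm p r ≤ moduleSeminorm p (r + (l : ℂ) • P r) := by
  refine le_of_sq_le_sq ?_ (moduleSeminorm_nonneg p _)
  rw [moduleSeminorm_sq, moduleSeminorm_sq]
  have e : inner A (r + (l : ℂ) • P r) (r + (l : ℂ) • P r) = inner A r r +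
      ((2 * l : ℝ) : ℂ) • inner A r (P r) + ((l ^ 2 : ℝ) : ℂ) • inner A (P r) (P r) := by
    simp only [PreHilbertModule.inner_add_right, inner_add_left_right, inner_ofReal_smul_left,
      PreHilbertModule.inner_smul_right, hsym]
    push_cast
    module
  rw [e]
  exact seminorm_le_add_add hp (PreHilbertModule.inner_self_pos r)
    ((hpos r).ofReal_smul (by positivity))
    ((PreHilbertModule.inner_self_pos (P r)).ofReal_smul (by positivity))

/-- Applying `1 + lP`, which does not decrease seminorms, turns `1 - lP` into `1 - l²P²`. The
first-order term cancels, so the excess over 1 is only quadratic in `l`. -/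
theorem moduleSeminorm_sub_smul_le (hp : p ∈ contCStarSeminorms A) {P : E →ₗ[ℂ] E}
    (hsym : ∀ x y, inner A (P x) y = inner A x (P y))
    (hpos : ∀ x, IsPositiveElem (inner A x (P x))) {K : ℝ} (hK : 0 ≤ K)
    (hPK : ∀ x, moduleSeminorm p (P x) ≤ K * moduleSeminorm p x) {l : ℝ} (hl : 0 ≤ l) (r : E) :
    moduleSeminorm p (r - (l : ℂ) • P r) ≤ (1 + l ^ 2 * K ^ 2) * moduleSeminorm p r := by
  refine (moduleSeminorm_le_add_smul hp hsym hpos hl _).trans ?_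
  have e : r - (l : ℂ) • P r + (l : ℂ) • P (r - (l : ℂ) • P r) =
      r - ((l ^ 2 : ℝ) : ℂ) • P (P r) := by
    rw [map_sub, map_smul]
    push_cast
    module
  rw [e]
  refine (moduleSeminorm_sub_le hp _ _).trans ?_
  rw [moduleSeminorm_ofReal_smul (by positivity)]
  have h1 := hPK (P r)
  have h2 := mul_le_mul_of_nonneg_left (hPK r) hK
  have h3 := mul_le_mul_of_nonneg_left (h1.trans h2) (sq_nonneg l)
  linarith

/-- For small `l` the gain `lε` from the shift beats the quadratic loss: factoring out `1 - lε`
leaves a loss of at most 2l²K² ≤ lε/4. -/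
theorem moduleSeminorm_richardson_step_le (hp : p ∈ contCStarSeminorms A) {P : E →ₗ[ℂ] E}
    (hsym : ∀ x y, inner A (P x) y = inner A x (P y))
    (hpos : ∀ x, IsPositiveElem (inner A x (P x))) {K : ℝ} (hK : 0 ≤ K)
    (hPK : ∀ x, moduleSeminorm p (P x) ≤ K * moduleSeminorm p x) {l ε : ℝ} (hl : 0 ≤ l)
    (h1 : l * ε ≤ 1 / 2) (h2 : 8 * l * K ^ 2 ≤ ε) (r : E) :
    moduleSeminorm p (r - (l : ℂ) • ((ε : ℂ) • r + P r)) ≤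
      (1 - l * ε / 2) * moduleSeminorm p r := by
  have hd : 0 < 1 - l * ε := by linarith
  have e : r - (l : ℂ) • ((ε : ℂ) • r + P r) =
      ((1 - l * ε : ℝ) : ℂ) • (r - ((l / (1 - l * ε) : ℝ) : ℂ) • P r) := by
    rw [smul_sub, smul_smul, ← Complex.ofReal_mul, mul_div_cancel₀ _ hd.ne']
    push_cast
    module
  rw [e, moduleSeminorm_ofReal_smul hd.le]
  refine (mul_le_mul_of_nonneg_left
    (moduleSeminorm_sub_smul_le hp hsym hpos hK hPK (div_nonneg hl hd.le) r) hd.le).trans ?_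
  rw [← mul_assoc]
  refine mul_le_mul_of_nonneg_right ?_ (moduleSeminorm_nonneg p r)
  have h3 : (1 - l * ε) * (1 + (l / (1 - l * ε)) ^ 2 * K ^ 2) =
      1 - l * ε + l / (1 - l * ε) * (l * K ^ 2) := by field_simp
  have h4 : l / (1 - l * ε) ≤ 2 * l := by
    rw [div_le_iff₀ hd]; nlinarith
  have h5 := mul_le_mul_of_nonneg_right h4 (by positivity : 0 ≤ l * K ^ 2)
  have h6 := mul_le_mul_of_nonneg_left h2 hl
  have h7 : 0 ≤ l * (8 * l * K ^ 2) := by positivity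
  rw [h3]
  linarith

end CStar

end PreHilbert

/-! ### Convergence and completeness in terms of the seminorms. -/

/-- The harmonic series diverges: since 1 - t ≤ exp(-t), the products `a n * exp (δ * H n)` do not
increase from `N` on, while `H n` → ∞. -/
theorem tendsto_zero_of_le_one_sub_div {a : ℕ → ℝ} {δ : ℝ} (hδ : 0 < δ) (ha : ∀ n, 0 ≤ a n)
    {N : ℕ} (h : ∀ n ≥ N, a (n + 1) ≤ (1 - 1 / ((n : ℝ) + 1) * δ) * a n) :
    Tendsto a atTop (𝓝 0) := by
  set H : ℕ → ℝ := fun n => ∑ i ∈ Finset.range n, 1 / ((i : ℝ) + 1) with hH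
  have hHt : Tendsto H atTop atTop := Real.tendsto_sum_range_one_div_nat_succ_atTop
  have hb : ∀ n ≥ N, a n * Real.exp (δ * H n) ≤ a N * Real.exp (δ * H N) := by
    intro n hn
    induction n, hn using Nat.le_induction with
    | base => exact le_rfl
    | succ n hn ih =>
      refine le_trans ?_ ih
      have e : H (n + 1) = H n + 1 / ((n : ℝ) + 1) := Finset.sum_range_succ _ _
      have h1 : 1 - 1 / ((n : ℝ) + 1) * δ ≤ Real.exp (-(1 / ((n : ℝ) + 1) * δ)) := by
        have := Real.add_one_le_exp (-(1 / ((n : ℝ) + 1) * δ))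
        linarith
      have h2 := (h n hn).trans (mul_le_mul_of_nonneg_right h1 (ha n))
      refine (mul_le_mul_of_nonneg_right h2 (Real.exp_pos _).le).trans (le_of_eq ?_)
      rw [mul_comm (Real.exp _) (a n), mul_assoc, ← Real.exp_add, e]
      congr 2
      ring
  have hlim : Tendsto (fun n => a N * Real.exp (δ * H N) * Real.exp (-(δ * H n))) atTop (𝓝 0) := by
    have h1 : Tendsto (fun n => δ * H n) atTop atTop := hHt.const_mul_atTop hδ
    have h2 := (Real.tendsto_exp_neg_atTop_nhds_zero.comp h1).const_mul (a N * Real.exp (δ * H N))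
    simpa using h2
  refine squeeze_zero' (Eventually.of_forall ha) ?_ hlim
  filter_upwards [eventually_ge_atTop N] with n hn
  rw [Real.exp_neg, ← div_eq_mul_inv, le_div_iff₀ (Real.exp_pos _)]
  exact hb n hn

/-- The constant filter at ⟨x, x⟩ converges to 0, so ⟨x, x⟩ = 0 because `A` is Hausdorff. -/
theorem eq_zero_of_forall_moduleSeminorm {A E : Type*}
    [NonUnitalRing A] [StarRing A] [Module ℂ A] [IsScalarTower ℂ A A] [SMulCommClass ℂ A A]
    [StarModule ℂ A] [UniformSpace A] [LocallyCStarAlgebra A]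
    [AddCommGroup E] [Module ℂ E] [SMul Aᵐᵒᵖ E] [PreHilbertModule A E] {x : E}
    (h : ∀ p ∈ contCStarSeminorms A, moduleSeminorm p x = 0) : x = 0 := by
  rw [← PreHilbertModule.inner_self_eq_zero (A := A), ← pure_le_nhds_iff,
    LocallyCStarAlgebra.tendsto_zero_iff]
  intro p hp
  rw [tendsto_pure_left]
  intro s hs
  rw [← moduleSeminorm_sq, h p hp]
  simpa using mem_of_mem_nhds hs

theorem IsBoundedMap.tendsto {A E F : Type*} [NonUnitalRing A] [StarRing A] [Module ℂ A]
    [TopologicalSpace A] [AddCommGroup E] [Module ℂ E] [SMul Aᵐᵒᵖ E] [PreHilbertModule A E]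
    [AddCommGroup F] [Module ℂ F] [SMul Aᵐᵒᵖ F] [PreHilbertModule A F] {T : E →ₗ[ℂ] F} (hT : IsBoundedMap A T)
    {ι : Type*} {l : Filter ι} {u : ι → E} {x : E}
    (hx : ∀ p ∈ contCStarSeminorms A, Tendsto (fun i => moduleSeminorm p (u i - x)) l (𝓝 0)) :
    ∀ p ∈ contCStarSeminorms A,
      Tendsto (fun i => moduleSeminorm p (T (u i) - T x)) l (𝓝 0) := by
  intro p hp
  obtain ⟨K, -, hK⟩ := hT p hp
  have h := (hx p hp).const_mul K
  rw [mul_zero] at h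
  refine squeeze_zero (fun i => moduleSeminorm_nonneg p _) (fun i => ?_) h
  rw [← map_sub]
  exact hK _

section Topology

variable (A : Type*) {E : Type*} [NonUnitalRing A] [StarRing A] [Module ℂ A] [TopologicalSpace A]
  [AddCommGroup E] [Module ℂ E] [SMul Aᵐᵒᵖ E] [PreHilbertModule A E]
  [UniformSpace E] [HilbertModule A E] {ι : Type*} {l : Filter ι} {f : ι → E}

theorem tendsto_iff_moduleSeminorm {y : E} : Tendsto f l (𝓝 y) ↔
    ∀ p ∈ contCStarSeminorms A, Tendsto (fun i => moduleSeminorm p (f i - y)) l (𝓝 0) := by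
  have := HilbertModule.isUniformAddGroup (A := A) (E := E)
  rw [← tendsto_sub_nhds_zero_iff, Tendsto, HilbertModule.tendsto_zero_iff (A := A)]
  rfl

/-- Completeness of a Hilbert module in terms of its seminorms. -/
theorem exists_tendsto_of_moduleSeminorm [l.NeBot]
    (h : ∀ p ∈ contCStarSeminorms A,
      Tendsto (fun i : ι × ι => moduleSeminorm p (f i.1 - f i.2)) (l ×ˢ l) (𝓝 0)) :
    ∃ y, Tendsto f l (𝓝 y) := by
  have := HilbertModule.isUniformAddGroup (A := A) (E := E)
  have := HilbertModule.completeSpace (A := A) (E := E)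
  have hc : Cauchy (map f l) := by
    refine ⟨inferInstance, ?_⟩
    rw [prod_map_map_eq, uniformity_eq_comap_nhds_zero_swapped, ← tendsto_iff_comap, Tendsto,
      map_map, HilbertModule.tendsto_zero_iff (A := A)]
    exact h
  exact CompleteSpace.complete hc

theorem exists_tendsto_of_bound {u : ℕ → E}
    (h : ∀ p ∈ contCStarSeminorms A, ∃ b : ℕ → ℝ, Tendsto b atTop (𝓝 0) ∧
      ∀ m n, moduleSeminorm p (u m - u n) ≤ b m + b n) :
    ∃ y, Tendsto u atTop (𝓝 y) := by
  refine exists_tendsto_of_moduleSeminorm A fun p hp => ?_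
  obtain ⟨b, hb, hu⟩ := h p hp
  have h2 : Tendsto (fun i : ℕ × ℕ => b i.1 + b i.2) (atTop ×ˢ atTop) (𝓝 0) := by
    simpa using (hb.comp tendsto_fst).add (hb.comp tendsto_snd)
  exact squeeze_zero (fun i => moduleSeminorm_nonneg p _) (fun i => hu i.1 i.2) h2

end Topology

/-! ### Resolvents of positive operators and the gliding hump. -/

section Hilbert

variable {A E F : Type*}
  [NonUnitalRing A] [StarRing A] [Module ℂ A] [IsScalarTower ℂ A A] [SMulCommClass ℂ A A]
  [StarModule ℂ A] [UniformSpace A] [LocallyCStarAlgebra A]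
  [AddCommGroup E] [Module ℂ E] [SMul Aᵐᵒᵖ E] [PreHilbertModule A E]

theorem eq_of_tendsto_moduleSeminorm {ι : Type*} {l : Filter ι} [l.NeBot] {x y : E} {u : ι → E}
    (hx : ∀ p ∈ contCStarSeminorms A, Tendsto (fun i => moduleSeminorm p (u i - x)) l (𝓝 0))
    (hy : ∀ p ∈ contCStarSeminorms A, Tendsto (fun i => moduleSeminorm p (u i - y)) l (𝓝 0)) :
    x = y := by
  rw [← sub_eq_zero]
  refine eq_zero_of_forall_moduleSeminorm (A := A) fun p hp => ?_
  refine le_antisymm ?_ (moduleSeminorm_nonneg p _)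
  have h := (hx p hp).add (hy p hp)
  rw [add_zero] at h
  refine ge_of_tendsto' h fun i => ?_
  have := moduleSeminorm_sub_le_add_sub hp x (u i) y
  rwa [moduleSeminorm_sub_rev hp x (u i)] at this

variable [UniformSpace E] [HilbertModule A E]
  [AddCommGroup F] [Module ℂ F] [SMul Aᵐᵒᵖ F] [PreHilbertModule A F]

/-- For a positive operator `P` and `ε > 0`, the operator `ε + P` is onto. -/
theorem exists_smul_add_eq {P : E →ₗ[ℂ] E} (hP : IsBoundedMap A P)
    (hsym : ∀ x y, inner A (P x) y = inner A x (P y))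
    (hpos : ∀ x, IsPositiveElem (inner A x (P x))) {G : Submodule ℂ E} (hG : IsClosed (G : Set E))
    (hPG : ∀ x ∈ G, P x ∈ G) {ε : ℝ} (hε : 0 < ε) {y : E} (hy : y ∈ G) :
    ∃ z ∈ G, (ε : ℂ) • z + P z = y := by
  set L : E →ₗ[ℂ] E := (ε : ℂ) • LinearMap.id + P with hL
  have hLap : ∀ x, L x = (ε : ℂ) • x + P x := fun x => rfl
  have hLlow : ∀ p ∈ contCStarSeminorms A, ∀ x : E,
      moduleSeminorm p x ≤ ε⁻¹ * moduleSeminorm p (L x) := by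
    intro p hp x
    have h := moduleSeminorm_le_add_smul hp hsym hpos (inv_nonneg.2 hε.le) x
    rw [← moduleSeminorm_ofReal_smul (inv_nonneg.2 hε.le), hLap, smul_add, smul_smul,
      ← Complex.ofReal_mul, inv_mul_cancel₀ hε.ne', Complex.ofReal_one, one_smul]
    exact h
  have hLb : IsBoundedMap A L := by
    intro p hp
    obtain ⟨K, hK, h⟩ := hP p hp
    refine ⟨ε + K, by positivity, fun x => ?_⟩
    rw [hLap, add_mul]
    refine (moduleSeminorm_add_le hp _ _).trans (add_le_add ?_ (h x))
    rw [moduleSeminorm_ofReal_smul hε.le]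
  -- The bound `K` of `P` depends on the seminorm, so no fixed step size suits them all. The steps
  -- 1/(n+1) are eventually small enough for each seminorm, yet have a divergent sum.
  let u : ℕ → E := fun n =>
    Nat.rec 0 (fun n v => v + ((1 / ((n : ℝ) + 1) : ℝ) : ℂ) • (y - L v)) n
  have hu : ∀ n, u (n + 1) = u n + ((1 / ((n : ℝ) + 1) : ℝ) : ℂ) • (y - L (u n)) := fun n => rfl
  have huG : ∀ n, u n ∈ G := by
    intro n
    induction n with
    | zero => exact G.zero_mem
    | succ n ih =>
      rw [hu]
      exact G.add_mem ih (G.smul_mem _ (G.sub_mem hy (G.add_mem (G.smul_mem _ ih) (hPG _ ih))))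
  have hres : ∀ p ∈ contCStarSeminorms A,
      Tendsto (fun n => moduleSeminorm p (y - L (u n))) atTop (𝓝 0) := by
    intro p hp
    obtain ⟨K, hK, h⟩ := hP p hp
    have h0 : Tendsto (fun n : ℕ => 1 / ((n : ℝ) + 1)) atTop (𝓝 0) :=
      tendsto_one_div_add_atTop_nhds_zero_nat
    have h1 : ∀ᶠ n : ℕ in atTop, 1 / ((n : ℝ) + 1) * ε ≤ 1 / 2 := by
      have := h0.mul_const ε
      rw [zero_mul] at this
      exact this.eventually_le_const (by norm_num)
    have h2 : ∀ᶠ n : ℕ in atTop, 8 * (1 / ((n : ℝ) + 1)) * K ^ 2 ≤ ε := by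
      have := (h0.const_mul 8).mul_const (K ^ 2)
      rw [mul_zero, zero_mul] at this
      exact this.eventually_le_const hε
    obtain ⟨N, hN⟩ := eventually_atTop.1 (h1.and h2)
    refine tendsto_zero_of_le_one_sub_div (half_pos hε) (fun n => moduleSeminorm_nonneg p _)
      (N := N) fun n hn => ?_
    have e : y - L (u (n + 1)) = (y - L (u n)) -
        ((1 / ((n : ℝ) + 1) : ℝ) : ℂ) • ((ε : ℂ) • (y - L (u n)) + P (y - L (u n))) := by
      rw [← hLap, hu, map_add, map_smul]
      abel
    have h3 := moduleSeminorm_richardson_step_le hp hsym hpos hK.le h (by positivity)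
      (hN n hn).1 (hN n hn).2 (y - L (u n))
    rw [e]
    refine h3.trans (le_of_eq ?_)
    ring
  obtain ⟨z, hz⟩ : ∃ z, Tendsto u atTop (𝓝 z) := by
    refine exists_tendsto_of_bound A fun p hp =>
      ⟨fun n => ε⁻¹ * moduleSeminorm p (y - L (u n)), ?_, fun m n => ?_⟩
    · simpa using (hres p hp).const_mul ε⁻¹
    · refine (hLlow p hp _).trans ?_
      rw [← mul_add]
      refine mul_le_mul_of_nonneg_left ?_ (inv_nonneg.2 hε.le)
      have e : L (u m - u n) = (y - L (u n)) - (y - L (u m)) := by rw [map_sub]; abel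
      rw [e, add_comm]
      exact moduleSeminorm_sub_le hp _ _
  refine ⟨z, hG.mem_of_tendsto hz (Eventually.of_forall huG), ?_⟩
  rw [← hLap]
  refine eq_of_tendsto_moduleSeminorm (A := A) (hLb.tendsto ((tendsto_iff_moduleSeminorm A).1 hz))
    fun p hp => ?_
  simp_rw [moduleSeminorm_sub_rev hp _ y]
  exact hres p hp

/-- An element `y` of a closed submodule is almost normed, for a given seminorm, by an element of
the submodule on which all seminorms are at most one. -/
theorem exists_bounded_almost_norming {G : Submodule ℂ E} (hG : IsClosed (G : Set E))
    (hGA : ∀ x ∈ G, ∀ a : A, x <• a ∈ G) {p : Seminorm ℂ A} (hp : p ∈ contCStarSeminorms A)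
    {y : E} (hy : y ∈ G) (hpy : 0 < moduleSeminorm p y) :
    ∃ z ∈ G, (∀ q ∈ contCStarSeminorms A, moduleSeminorm q z ≤ 1) ∧
      moduleSeminorm p y / 4 ≤ p (inner A y z) := by
  set s := moduleSeminorm p y with hs
  let P : E →ₗ[ℂ] E :=
    { toFun := fun w => y <• inner A y w
      map_add' := fun w w' => by
        rw [PreHilbertModule.inner_add_right, PreHilbertModule.op_smul_add]
      map_smul' := fun c w => by
        rw [PreHilbertModule.inner_smul_right, PreHilbertModule.op_smul_smul, RingHom.id_apply] }
  have hPap : ∀ w, P w = y <• inner A y w := fun w => rfl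
  have hP : IsBoundedMap A P := by
    intro q hq
    refine ⟨moduleSeminorm q y * moduleSeminorm q y + 1,
      by linarith [mul_self_nonneg (moduleSeminorm q y)], fun w => ?_⟩
    have h1 := moduleSeminorm_op_smul_le hq y (inner A y w)
    have h2 := mul_le_mul_of_nonneg_left (seminorm_inner_le hq y w) (moduleSeminorm_nonneg q y)
    have h3 := moduleSeminorm_nonneg q w
    rw [hPap]
    linarith
  have hsym : ∀ x w, inner A (P x) w = inner A x (P w) := by
    intro x w
    rw [hPap, hPap, inner_op_smul_left, PreHilbertModule.inner_op_smul_right,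
      PreHilbertModule.star_inner]
  have hpos : ∀ x, IsPositiveElem (inner A x (P x)) := by
    intro x
    refine ⟨inner A y x, ?_⟩
    rw [hPap, PreHilbertModule.inner_op_smul_right, PreHilbertModule.star_inner]
  -- `z` will solve εz + y⟨y, z⟩ = εy. Every seminorm of `z` is then at most √ε, which this choice
  -- makes s/2.
  set ε : ℝ := s ^ 2 / 4 with hε
  have hε0 : 0 < ε := by positivity
  obtain ⟨z, hzG, hz⟩ := exists_smul_add_eq hP hsym hpos hG (fun x _ => hGA y hy _) hε0
    (G.smul_mem (ε : ℂ) hy)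
  set b := inner A y z with hb
  -- Pair the equation for `z` with `z`. Monotonicity then gives q(b)² ≤ ε q(b) and ‖z‖_q² ≤ q(b)
  -- for every `q` at once.
  have hbz : (ε : ℂ) • b = star b * b + (ε : ℂ) • inner A z z := by
    have h := congrArg (fun v => inner A v z) hz
    simp only [inner_add_left_right, inner_ofReal_smul_left, hPap, inner_op_smul_left, ← hb] at h
    rw [← h, add_comm]
  have hbb : IsPositiveElem (star b * b) := ⟨b, rfl⟩
  have hzz : IsPositiveElem ((ε : ℂ) • inner A z z) :=
    (PreHilbertModule.inner_self_pos z).ofReal_smul hε0.le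
  have hε1 : ∀ (q : Seminorm ℂ A) (a : A), q ((ε : ℂ) • a) = ε * q a := by
    intro q a
    rw [map_smul_eq_mul, Complex.norm_real, Real.norm_of_nonneg hε0.le]
  have hzs : ∀ q ∈ contCStarSeminorms A, moduleSeminorm q z ≤ s / 2 := by
    intro q hq
    have h1 := seminorm_le_add hq hbb hzz
    have h2 := seminorm_le_add hq hzz hbb
    rw [← hbz, hq.2.2, hε1] at h1
    rw [add_comm, ← hbz, hε1, hε1, ← moduleSeminorm_sq] at h2
    have h3 : q b ≤ ε := by
      by_contra hc
      push Not at hc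
      nlinarith
    have h4 : moduleSeminorm q z ^ 2 ≤ q b := le_of_mul_le_mul_left h2 hε0
    refine le_of_sq_le_sq ?_ (by positivity)
    refine (h4.trans h3).trans (le_of_eq ?_)
    rw [hε]; ring
  have hpb : s ^ 2 / 8 ≤ p b := by
    have h1 : moduleSeminorm p ((ε : ℂ) • y) ≤ ε * (s / 2) + s * p b := by
      rw [← hz]
      refine (moduleSeminorm_add_le hp _ _).trans (add_le_add ?_ ?_)
      · rw [moduleSeminorm_ofReal_smul hε0.le]
        exact mul_le_mul_of_nonneg_left (hzs p hp) hε0.le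
      · exact moduleSeminorm_op_smul_le hp y b
    rw [moduleSeminorm_ofReal_smul hε0.le, ← hs, hε] at h1
    refine le_of_mul_le_mul_left ?_ hpy
    linarith
  refine ⟨((2 / s : ℝ) : ℂ) • z, G.smul_mem _ hzG, fun q hq => ?_, ?_⟩
  · rw [moduleSeminorm_ofReal_smul (by positivity)]
    have := mul_le_mul_of_nonneg_left (hzs q hq) (by positivity : 0 ≤ 2 / s)
    refine this.trans (le_of_eq ?_)
    field_simp
  · rw [PreHilbertModule.inner_smul_right, ← hb, map_smul_eq_mul, Complex.norm_real,
      Real.norm_of_nonneg (by positivity)]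
    have := mul_le_mul_of_nonneg_left hpb (by positivity : 0 ≤ 2 / s)
    refine le_trans (le_of_eq ?_) this
    field_simp
    norm_num

omit [LocallyCStarAlgebra A] in
/-- Condensation of singularities: the gliding hump argument in a closed submodule. -/
theorem exists_seminorm_inner_ge {G : Submodule ℂ E} (hG : IsClosed (G : Set E))
    {p : Seminorm ℂ A} (hp : p ∈ contCStarSeminorms A) {y z : ℕ → E} (hzG : ∀ n, z n ∈ G)
    (hz : ∀ n, ∀ q ∈ contCStarSeminorms A, moduleSeminorm q (z n) ≤ 1)
    (hyz : ∀ n, moduleSeminorm p (y n) / 4 ≤ p (inner A (y n) (z n))) :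
    ∃ x ∈ G, ∀ n, 5 / 36 * (1 / 10) ^ n * moduleSeminorm p (y n) ≤ p (inner A (y n) x) := by
  -- One of the signs in c = ±10⁻ⁿ works: the two values of the inner product differ by 2·10⁻ⁿ⟨y n,
  -- z n⟩, so they cannot both be small.
  have step : ∀ n (x : E), ∃ c : ℂ, ‖c‖ = (1 / 10) ^ n ∧
      (1 / 10) ^ n * (moduleSeminorm p (y n) / 4) ≤ p (inner A (y n) (x + c • z n)) := by
    intro n x
    set d : ℂ := (((1 / 10) ^ n : ℝ) : ℂ) with hd
    have hdn : ‖d‖ = (1 / 10) ^ n := by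
      rw [hd, Complex.norm_real, Real.norm_of_nonneg (by positivity)]
    by_contra! hc
    have h1 := hc d hdn
    have h2 := hc (-d) (by rw [norm_neg, hdn])
    have e : (2 : ℂ) • d • inner A (y n) (z n) =
        inner A (y n) (x + d • z n) - inner A (y n) (x + (-d) • z n) := by
      simp only [PreHilbertModule.inner_add_right, PreHilbertModule.inner_smul_right]
      module
    have h3 := map_sub_le_add p (inner A (y n) (x + d • z n)) (inner A (y n) (x + (-d) • z n))
    rw [← e, map_smul_eq_mul, map_smul_eq_mul, hdn] at h3
    have h4 := mul_le_mul_of_nonneg_left (hyz n) (by positivity : (0 : ℝ) ≤ (1 / 10) ^ n)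
    simp only [Complex.norm_ofNat] at h3
    linarith
  choose c hc hcx using step
  let x : ℕ → E := fun n => Nat.rec 0 (fun n v => v + c n v • z n) n
  have hx : ∀ n, x (n + 1) = x n + c n (x n) • z n := fun n => rfl
  have hxG : ∀ n, x n ∈ G := by
    intro n
    induction n with
    | zero => exact G.zero_mem
    | succ n ih => rw [hx]; exact G.add_mem ih (G.smul_mem _ (hzG n))
  have hstep : ∀ q ∈ contCStarSeminorms A, ∀ n,
      moduleSeminorm q (x (n + 1) - x n) ≤ (1 / 10) ^ n := by
    intro q hq n
    rw [hx, add_sub_cancel_left, moduleSeminorm_smul, hc]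
    have := mul_le_mul_of_nonneg_left (hz n q hq) (by positivity : (0 : ℝ) ≤ (1 / 10) ^ n)
    simpa using this
  have hle : ∀ q ∈ contCStarSeminorms A, ∀ n k,
      moduleSeminorm q (x (n + k) - x n) ≤ 10 / 9 * ((1 / 10) ^ n - (1 / 10) ^ (n + k)) := by
    intro q hq n k
    induction k with
    | zero => simp [moduleSeminorm_zero hq]
    | succ k ih =>
      have h1 := moduleSeminorm_sub_le_add_sub hq (x (n + k + 1)) (x (n + k)) (x n)
      have h2 := hstep q hq (n + k)
      rw [← add_assoc, pow_succ (1 / 10 : ℝ) (n + k)]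
      linarith
  have hle' : ∀ q ∈ contCStarSeminorms A, ∀ n m, n ≤ m →
      moduleSeminorm q (x m - x n) ≤ 10 / 9 * (1 / 10) ^ n := by
    intro q hq n m hnm
    obtain ⟨k, rfl⟩ := Nat.exists_eq_add_of_le hnm
    have h1 := hle q hq n k
    have h2 : (0 : ℝ) ≤ (1 / 10) ^ (n + k) := by positivity
    linarith
  obtain ⟨w, hw⟩ : ∃ w, Tendsto x atTop (𝓝 w) := by
    refine exists_tendsto_of_bound A fun q hq => ⟨fun n => 10 / 9 * (1 / 10) ^ n, ?_, ?_⟩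
    · have := (tendsto_pow_atTop_nhds_zero_of_lt_one (r := (1 / 10 : ℝ)) (by norm_num)
        (by norm_num)).const_mul (10 / 9)
      rwa [mul_zero] at this
    · intro m n
      have hm : (0 : ℝ) ≤ (1 / 10) ^ m := by positivity
      have hn : (0 : ℝ) ≤ (1 / 10) ^ n := by positivity
      rcases le_total m n with h | h
      · rw [moduleSeminorm_sub_rev hq]
        have := hle' q hq m n h
        linarith
      · have := hle' q hq n m h
        linarith
  refine ⟨w, hG.mem_of_tendsto hw (Eventually.of_forall hxG), fun n => ?_⟩
  -- The later humps cost at most (10/9)·(1/10) = 1/9 of 10⁻ⁿ‖y n‖_p, which leaves 1/4 - 1/9 = 5/36.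
  have hlim : moduleSeminorm p (w - x (n + 1)) ≤ 10 / 9 * (1 / 10) ^ (n + 1) := by
    have h1 := ((tendsto_iff_moduleSeminorm A).1 hw p hp).add_const (10 / 9 * (1 / 10) ^ (n + 1))
    rw [zero_add] at h1
    refine ge_of_tendsto h1 ?_
    filter_upwards [eventually_ge_atTop (n + 1)] with m hm
    have h2 := moduleSeminorm_sub_le_add_sub hp w (x m) (x (n + 1))
    rw [moduleSeminorm_sub_rev hp w (x m)] at h2
    linarith [hle' p hp _ _ hm]
  have h1 := hcx n (x n)
  rw [← hx] at h1
  have h2 := seminorm_inner_le hp (y n) (w - x (n + 1))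
  have h3 := mul_le_mul_of_nonneg_left hlim (moduleSeminorm_nonneg p (y n))
  have h4 := map_sub_le_add p (inner A (y n) w) (inner A (y n) (w - x (n + 1)))
  rw [← inner_sub_right_eq, sub_sub_cancel] at h4
  rw [pow_succ] at h3
  linarith

end Hilbert

/-! ### Closed range, complemented kernel and lower bounds. -/

section ClosedRange

variable {A E F : Type*}
  [NonUnitalRing A] [StarRing A] [Module ℂ A] [IsScalarTower ℂ A A] [SMulCommClass ℂ A A]
  [StarModule ℂ A] [UniformSpace A] [LocallyCStarAlgebra A]
  [AddCommGroup E] [Module ℂ E] [SMul Aᵐᵒᵖ E] [PreHilbertModule A E]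
  [AddCommGroup F] [Module ℂ F] [SMul Aᵐᵒᵖ F] [PreHilbertModule A F]
  [UniformSpace F] [HilbertModule A F]

/-- If the range of `T` is closed, the adjoint of `T` is bounded below on it. -/
theorem exists_moduleSeminorm_le_adjoint {T : E →ₗ[ℂ] F} (hTA : IsModuleMap A T)
    {S : F →ₗ[ℂ] E} (hS : ∀ x y, inner A (T x) y = inner A x (S y))
    (hcl : IsClosed (LinearMap.range T : Set F)) {p : Seminorm ℂ A}
    (hp : p ∈ contCStarSeminorms A) :
    ∃ C : ℝ, 0 < C ∧ ∀ y ∈ LinearMap.range T, moduleSeminorm p y ≤ C * moduleSeminorm p (S y) := by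
  by_contra! hcon
  -- Growth 100^n against hump sizes 10⁻ⁿ leaves the unbounded lower bound (5/36)·10^n.
  have hy : ∀ n : ℕ, ∃ y ∈ LinearMap.range T, moduleSeminorm p y = 100 ^ n ∧
      moduleSeminorm p (S y) ≤ 1 := by
    intro n
    obtain ⟨y, hy, hlt⟩ := hcon (100 ^ n) (by positivity)
    have h0 := moduleSeminorm_nonneg p (S y)
    have hpos : 0 < moduleSeminorm p y := lt_of_le_of_lt (by positivity) hlt
    refine ⟨((100 ^ n / moduleSeminorm p y : ℝ) : ℂ) • y, Submodule.smul_mem _ _ hy, ?_, ?_⟩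
    · rw [moduleSeminorm_ofReal_smul (by positivity), div_mul_cancel₀ _ hpos.ne']
    · rw [map_smul, moduleSeminorm_ofReal_smul (by positivity), div_mul_eq_mul_div,
        div_le_one hpos]
      exact hlt.le
  choose y hyR hyn hSy using hy
  have hz : ∀ n, ∃ z ∈ LinearMap.range T,
      (∀ q ∈ contCStarSeminorms A, moduleSeminorm q z ≤ 1) ∧
      moduleSeminorm p (y n) / 4 ≤ p (inner A (y n) z) := fun n =>
    exists_bounded_almost_norming hcl (fun x hx a => op_smul_mem_range hTA hx a) hp (hyR n)
      (by rw [hyn]; positivity)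
  choose z hzR hz1 hyz using hz
  obtain ⟨_, ⟨e, rfl⟩, he⟩ := exists_seminorm_inner_ge hcl hp hzR hz1 hyz
  have hb : ∀ n : ℕ, 5 / 36 * (10 : ℝ) ^ n ≤ moduleSeminorm p e := by
    intro n
    have h1 := he n
    have h2 := seminorm_inner_le hp e (S (y n))
    have h3 := mul_le_mul_of_nonneg_left (hSy n) (moduleSeminorm_nonneg p e)
    rw [← hS, ← PreHilbertModule.star_inner, seminorm_star hp] at h2
    have e10 : (1 / 10 : ℝ) ^ n * 100 ^ n = 10 ^ n := by
      rw [← mul_pow]; norm_num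
    rw [hyn, mul_assoc, e10] at h1
    linarith
  obtain ⟨n, hn⟩ := pow_unbounded_of_one_lt (moduleSeminorm p e * (36 / 5))
    (by norm_num : (1 : ℝ) < 10)
  have := hb n
  linarith

/-- If the range of `T` is closed, `T T*` is onto it. -/
theorem exists_map_adjoint_eq {T : E →ₗ[ℂ] F} (hTA : IsModuleMap A T) (hT : IsBoundedMap A T)
    {S : F →ₗ[ℂ] E} (hS : ∀ x y, inner A (T x) y = inner A x (S y))
    (hcl : IsClosed (LinearMap.range T : Set F)) {y : F} (hy : y ∈ LinearMap.range T) :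
    ∃ z ∈ LinearMap.range T, T (S z) = y := by
  set P : F →ₗ[ℂ] F := T ∘ₗ S with hP
  have hPap : ∀ x, P x = T (S x) := fun _ => rfl
  have hS' : ∀ x y, inner A (S x) y = inner A x (T y) := fun x y => by
    rw [← PreHilbertModule.star_inner, ← hS, PreHilbertModule.star_inner]
  have hPb : IsBoundedMap A P := by
    intro p hp
    obtain ⟨K, hK, h⟩ := hT p hp
    refine ⟨K * K, mul_pos hK hK, fun x => (h _).trans ?_⟩
    rw [mul_assoc]
    exact mul_le_mul_of_nonneg_left (moduleSeminorm_adjoint_le hp hS hK.le h x) hK.le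
  have hsym : ∀ x w, inner A (P x) w = inner A x (P w) := fun x w => by
    rw [hPap, hPap, hS, hS']
  have hpos : ∀ x, IsPositiveElem (inner A x (P x)) := fun x => by
    rw [hPap, ← hS']
    exact PreHilbertModule.inner_self_pos _
  -- ‖x‖² ≤ C²‖Sx‖² and ‖Sx‖² = p⟨x, Px⟩ ≤ ‖x‖‖Px‖, so D = C² works.
  have hlow : ∀ p ∈ contCStarSeminorms A, ∃ D : ℝ, 0 < D ∧ ∀ x ∈ LinearMap.range T,
      moduleSeminorm p x ≤ D * moduleSeminorm p (P x) := by
    intro p hp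
    obtain ⟨C, hC, h⟩ := exists_moduleSeminorm_le_adjoint hTA hS hcl hp
    refine ⟨C ^ 2, by positivity, fun x hx => ?_⟩
    have h1 := seminorm_inner_le hp x (P x)
    rw [hPap, ← hS', ← moduleSeminorm_sq, ← hPap] at h1
    have h2 : moduleSeminorm p x ^ 2 ≤ (C * moduleSeminorm p (S x)) ^ 2 :=
      pow_le_pow_left₀ (moduleSeminorm_nonneg p x) (h x hx) 2
    have h3 := mul_le_mul_of_nonneg_left h1 (sq_nonneg C)
    rcases (moduleSeminorm_nonneg p x).eq_or_lt with h0 | h0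
    · rw [← h0]
      exact mul_nonneg (sq_nonneg C) (moduleSeminorm_nonneg p _)
    · refine le_of_mul_le_mul_left ?_ h0
      nlinarith
  have hex : ∀ n : ℕ, ∃ z ∈ LinearMap.range T, ((1 / ((n : ℝ) + 1) : ℝ) : ℂ) • z + P z = y :=
    fun n => exists_smul_add_eq hPb hsym hpos hcl (fun x _ => ⟨S x, rfl⟩) (by positivity) hy
  choose z hzR hz using hex
  have hPz : ∀ n, P (z n) = y - ((1 / ((n : ℝ) + 1) : ℝ) : ℂ) • z n := fun n => by
    rw [← hz n, add_sub_cancel_left]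
  have h0 : Tendsto (fun n : ℕ => 1 / ((n : ℝ) + 1)) atTop (𝓝 0) :=
    tendsto_one_div_add_atTop_nhds_zero_nat
  have hres : ∀ p ∈ contCStarSeminorms A,
      Tendsto (fun n => moduleSeminorm p (P (z n) - y)) atTop (𝓝 0) := by
    intro p hp
    obtain ⟨D, hD, h⟩ := hlow p hp
    -- The residual is `z n`/(n+1), and ‖z n‖ ≤ D‖P (z n)‖ ≤ D(‖y‖ + ‖z n‖/(n+1)). Once D/(n+1) ≤
    -- 1/2, the last term is absorbed and ‖z n‖ ≤ 2D‖y‖.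
    have h1 : Tendsto (fun n : ℕ => 1 / ((n : ℝ) + 1) * (2 * D * moduleSeminorm p y)) atTop
        (𝓝 0) := by simpa using h0.mul_const (2 * D * moduleSeminorm p y)
    refine squeeze_zero' (Eventually.of_forall fun n => moduleSeminorm_nonneg p _) ?_ h1
    have h2 := h0.mul_const D
    rw [zero_mul] at h2
    filter_upwards [h2.eventually_le_const (by norm_num : (0 : ℝ) < 1 / 2)] with n hn
    rw [moduleSeminorm_sub_rev hp, hPz, sub_sub_cancel,
      moduleSeminorm_ofReal_smul (by positivity)]
    refine mul_le_mul_of_nonneg_left ?_ (by positivity)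
    have h3 := h (z n) (hzR n)
    have h4 := moduleSeminorm_sub_le hp y (((1 / ((n : ℝ) + 1) : ℝ) : ℂ) • z n)
    rw [← hPz, moduleSeminorm_ofReal_smul (by positivity)] at h4
    have h5 := mul_le_mul_of_nonneg_left h4 hD.le
    have h6 := mul_le_mul_of_nonneg_right hn (moduleSeminorm_nonneg p (z n))
    linarith
  obtain ⟨w, hw⟩ : ∃ w, Tendsto z atTop (𝓝 w) := by
    refine exists_tendsto_of_bound A fun p hp => ?_
    obtain ⟨D, hD, h⟩ := hlow p hp
    refine ⟨fun n => D * moduleSeminorm p (P (z n) - y), ?_, fun m n => ?_⟩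
    · simpa using (hres p hp).const_mul D
    · refine (h _ (Submodule.sub_mem _ (hzR m) (hzR n))).trans ?_
      rw [← mul_add]
      refine mul_le_mul_of_nonneg_left ?_ hD.le
      rw [map_sub, moduleSeminorm_sub_rev hp (P (z n)) y]
      exact moduleSeminorm_sub_le_add_sub hp _ _ _
  exact ⟨w, hcl.mem_of_tendsto hw (Eventually.of_forall hzR),
    eq_of_tendsto_moduleSeminorm (A := A)
      (hPb.tendsto ((tendsto_iff_moduleSeminorm A).1 hw)) hres⟩

omit [IsScalarTower ℂ A A] [SMulCommClass ℂ A A] [StarModule ℂ A] [UniformSpace A]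
  [LocallyCStarAlgebra A] in
theorem eq_zero_of_mem_orthCompl {X : Submodule ℂ E} {x : E} (hx : x ∈ X)
    (hx' : x ∈ orthCompl A X) : x = 0 :=
  (PreHilbertModule.inner_self_eq_zero (A := A) x).1 (hx' x hx)

omit [IsScalarTower ℂ A A] [SMulCommClass ℂ A A] [StarModule ℂ A] [UniformSpace A]
  [LocallyCStarAlgebra A] in
theorem op_smul_mem_orthCompl {X : Submodule ℂ E} {x : E} (hx : x ∈ orthCompl A X) (a : A) :
    x <• a ∈ orthCompl A X := fun w hw => by
  rw [PreHilbertModule.inner_op_smul_right, hx w hw, zero_mul]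

omit [IsScalarTower ℂ A A] [SMulCommClass ℂ A A] [StarModule ℂ A] [UniformSpace A]
  [LocallyCStarAlgebra A] [UniformSpace F] [HilbertModule A F] in
theorem adjoint_mem_orthCompl_ker {T : E →ₗ[ℂ] F} {S : F →ₗ[ℂ] E}
    (hS : ∀ x y, inner A (T x) y = inner A x (S y)) (y : F) :
    S y ∈ orthCompl A (LinearMap.ker T) := fun x hx => by
  rw [← hS, LinearMap.mem_ker.1 hx, ← PreHilbertModule.star_inner, inner_zero_right_eq, star_zero]

theorem isOrthogonallyComplemented_ker_of_isClosed_range {T : E →ₗ[ℂ] F}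
    (hT : T ∈ adjointableMaps A E F) (hcl : IsClosed (LinearMap.range T : Set F)) :
    IsOrthogonallyComplemented A (LinearMap.ker T) := by
  obtain ⟨hTA, hTb, S, -, hS⟩ := hT
  refine ⟨Submodule.disjoint_def.2 fun x => eq_zero_of_mem_orthCompl, ?_⟩
  rw [codisjoint_iff, Submodule.eq_top_iff']
  intro x
  obtain ⟨z, -, hz⟩ := exists_map_adjoint_eq hTA hTb hS hcl (LinearMap.mem_range_self T x)
  refine Submodule.mem_sup.2 ⟨x - S z, ?_, S z, adjoint_mem_orthCompl_ker hS z,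
    sub_add_cancel _ _⟩
  rw [LinearMap.mem_ker, map_sub, hz, sub_self]

/-- An `x` in Ker(T)^⊥ equals `S z` with `z` in the range, as `x - S z` lies in both Ker(T) and its
complement. Then ‖x‖² = p⟨Tx, z⟩ ≤ ‖Tx‖‖z‖ ≤ C‖Tx‖‖x‖. -/
theorem exists_bounded_below_of_isClosed_range {T : E →ₗ[ℂ] F}
    (hT : T ∈ adjointableMaps A E F) (hcl : IsClosed (LinearMap.range T : Set F))
    {p : Seminorm ℂ A} (hp : p ∈ contCStarSeminorms A) :
    ∃ c : ℝ, 0 < c ∧ ∀ x ∈ orthCompl A (LinearMap.ker T),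
      c * moduleSeminorm p x ≤ moduleSeminorm p (T x) := by
  obtain ⟨hTA, hTb, S, -, hS⟩ := hT
  obtain ⟨C, hC, h⟩ := exists_moduleSeminorm_le_adjoint hTA hS hcl hp
  refine ⟨C⁻¹, inv_pos.2 hC, fun x hx => ?_⟩
  obtain ⟨z, hzR, hz⟩ := exists_map_adjoint_eq hTA hTb hS hcl (LinearMap.mem_range_self T x)
  have hxS : x = S z := by
    rw [← sub_eq_zero]
    refine eq_zero_of_mem_orthCompl (A := A) (X := LinearMap.ker T) ?_
      (Submodule.sub_mem _ hx (adjoint_mem_orthCompl_ker hS z))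
    rw [LinearMap.mem_ker, map_sub, hz, sub_self]
  have h1 := h z hzR
  rw [← hxS] at h1
  have h2 := seminorm_inner_le hp (T x) z
  rw [hS, ← hxS, ← moduleSeminorm_sq] at h2
  rw [inv_mul_le_iff₀ hC]
  have h3 := mul_le_mul_of_nonneg_left h1 (moduleSeminorm_nonneg p (T x))
  rcases (moduleSeminorm_nonneg p x).eq_or_lt with h0 | h0
  · rw [← h0]
    exact mul_nonneg hC.le (moduleSeminorm_nonneg p _)
  · refine le_of_mul_le_mul_left ?_ h0
    nlinarith

omit [IsScalarTower ℂ A A] [SMulCommClass ℂ A A] [StarModule ℂ A] [UniformSpace A]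
  [LocallyCStarAlgebra A] [UniformSpace F] [HilbertModule A F] [SMul Aᵐᵒᵖ F]
  [PreHilbertModule A F] in
theorem exists_mem_orthCompl_map_eq {T : E →ₗ[ℂ] F}
    (hker : IsOrthogonallyComplemented A (LinearMap.ker T)) {y : F}
    (hy : y ∈ LinearMap.range T) : ∃ x ∈ orthCompl A (LinearMap.ker T), T x = y := by
  obtain ⟨x, rfl⟩ := hy
  obtain ⟨k, hk, w, hw, rfl⟩ := Submodule.mem_sup.1
    ((codisjoint_iff.1 hker.codisjoint).symm ▸ Submodule.mem_top : x ∈ LinearMap.ker T ⊔ _)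
  exact ⟨w, hw, by rw [map_add, LinearMap.mem_ker.1 hk, zero_add]⟩

theorem isClosed_range_of_bounded_below [UniformSpace E] [HilbertModule A E] {T : E →ₗ[ℂ] F}
    (hT : IsBoundedMap A T) (hker : IsOrthogonallyComplemented A (LinearMap.ker T))
    (hlow : ∀ p ∈ contCStarSeminorms A, ∃ c : ℝ, 0 < c ∧
      ∀ x ∈ orthCompl A (LinearMap.ker T), c * moduleSeminorm p x ≤ moduleSeminorm p (T x)) :
    IsClosed (LinearMap.range T : Set F) := by
  refine isClosed_of_closure_subset fun y hy => ?_
  -- The topology of `F` need not be first countable, so a limit point is reached along the trace of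
  -- its neighbourhood filter rather than along a sequence.
  have hne : (comap ((↑) : LinearMap.range T → F) (𝓝 y)).NeBot :=
    mem_closure_iff_comap_neBot.1 hy
  have hval : Tendsto ((↑) : LinearMap.range T → F) (comap (↑) (𝓝 y)) (𝓝 y) := tendsto_comap
  generalize comap ((↑) : LinearMap.range T → F) (𝓝 y) = l at *
  choose u hu hTu using fun v : LinearMap.range T => exists_mem_orthCompl_map_eq hker v.2
  rw [tendsto_iff_moduleSeminorm A] at hval
  obtain ⟨x, hx⟩ : ∃ x, Tendsto u l (𝓝 x) := by
    refine exists_tendsto_of_moduleSeminorm A fun p hp => ?_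
    obtain ⟨c, hc, h⟩ := hlow p hp
    have h1 := (((hval p hp).comp tendsto_fst).add
      ((hval p hp).comp tendsto_snd) : Tendsto _ (l ×ˢ l) _).const_mul c⁻¹
    rw [add_zero, mul_zero] at h1
    refine squeeze_zero (fun i => moduleSeminorm_nonneg p _) (fun i => ?_) h1
    have h2 := h _ (Submodule.sub_mem _ (hu i.1) (hu i.2))
    rw [map_sub, hTu, hTu] at h2
    have h3 := moduleSeminorm_sub_le_add_sub hp (i.1 : F) y i.2
    rw [moduleSeminorm_sub_rev hp y] at h3
    rw [← div_eq_inv_mul, le_div_iff₀ hc, mul_comm]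
    exact h2.trans h3
  refine ⟨x, eq_of_tendsto_moduleSeminorm (A := A)
    (hT.tendsto ((tendsto_iff_moduleSeminorm A).1 hx)) ?_⟩
  simpa only [hTu] using hval

end ClosedRange

theorem mainTheorem4 {A E F : Type*}
    [NonUnitalRing A] [StarRing A] [Module ℂ A] [IsScalarTower ℂ A A] [SMulCommClass ℂ A A]
    [StarModule ℂ A] [UniformSpace A] [LocallyCStarAlgebra A]
    [AddCommGroup E] [Module ℂ E] [SMul Aᵐᵒᵖ E] [PreHilbertModule A E]
    [UniformSpace E] [HilbertModule A E]
    [AddCommGroup F] [Module ℂ F] [SMul Aᵐᵒᵖ F] [PreHilbertModule A F]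
    [UniformSpace F] [HilbertModule A F]
    (T : E →ₗ[ℂ] F) (hT : T ∈ adjointableMaps A E F) :
    (IsClosed (LinearMap.range T : Set F) ↔
      IsOrthogonallyComplemented A (LinearMap.ker T) ∧
      ∀ p ∈ contCStarSeminorms A, ∃ c : ℝ, 0 < c ∧
        ∀ x ∈ orthCompl A (LinearMap.ker T),
          c * moduleSeminorm p x ≤ moduleSeminorm p (T x)) ∧
    (IsClosed (LinearMap.range T : Set F) →
      ∃ R : LinearMap.range T →ₗ[ℂ] orthCompl A (LinearMap.ker T),
        R ∘ₗ restrictKerCompl A T = LinearMap.id ∧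
        restrictKerCompl A T ∘ₗ R = LinearMap.id ∧
        (∀ (y : LinearMap.range T) (a : A),
          (R ⟨(y : F) <• a, op_smul_mem_range hT.1 y.2 a⟩ : E) = (R y : E) <• a) ∧
        ∀ p ∈ contCStarSeminorms A, ∃ K : ℝ, 0 < K ∧
          ∀ y : LinearMap.range T,
            moduleSeminorm p (R y : E) ≤ K * moduleSeminorm p (y : F)) := by
  refine ⟨⟨fun hcl => ⟨isOrthogonallyComplemented_ker_of_isClosed_range hT hcl,
    fun p hp => exists_bounded_below_of_isClosed_range hT hcl hp⟩,
    fun h => isClosed_range_of_bounded_below hT.2.1 h.1 h.2⟩, fun hcl => ?_⟩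
  have hker := isOrthogonallyComplemented_ker_of_isClosed_range hT hcl
  have hcoe : ∀ x, (restrictKerCompl A T x : F) = T x := fun _ => rfl
  have hinj : Function.Injective (restrictKerCompl A T) := by
    rw [injective_iff_map_eq_zero]
    intro x hx
    refine Subtype.ext (eq_zero_of_mem_orthCompl (A := A) (X := LinearMap.ker T) ?_ x.2)
    rw [LinearMap.mem_ker, ← hcoe, hx, ZeroMemClass.coe_zero]
  have hsurj : Function.Surjective (restrictKerCompl A T) := fun y => by
    obtain ⟨x, hx, hxy⟩ := exists_mem_orthCompl_map_eq hker y.2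
    exact ⟨⟨x, hx⟩, Subtype.ext hxy⟩
  let e := LinearEquiv.ofBijective (restrictKerCompl A T) ⟨hinj, hsurj⟩
  have he : ∀ y, restrictKerCompl A T (e.symm y) = y := fun y => e.apply_symm_apply y
  have heT : ∀ y, T (e.symm y : E) = y := fun y => by rw [← hcoe, he]
  refine ⟨e.symm, LinearMap.ext fun x => e.symm_apply_apply x, LinearMap.ext he,
    fun y a => ?_, fun p hp => ?_⟩
  · have h : e.symm ⟨(y : F) <• a, op_smul_mem_range hT.1 y.2 a⟩ =
        ⟨(e.symm y : E) <• a, op_smul_mem_orthCompl (e.symm y).2 a⟩ := by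
      refine hinj (Subtype.ext ?_)
      rw [he, hcoe, hT.1, heT]
    exact congrArg Subtype.val h
  · obtain ⟨c, hc, h⟩ := exists_bounded_below_of_isClosed_range hT hcl hp
    refine ⟨c⁻¹, inv_pos.2 hc, fun y => ?_⟩
    have h1 := h _ (e.symm y).2
    rw [heT] at h1
    rw [← div_eq_inv_mul, le_div_iff₀ hc, mul_comm]
    exact h1
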